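/- For $d\ge 0$ and $n\in\mathbb Z^d$ put $Q_n=\{x\in\mathbb R^d: |x-n|\le\sqrt d\}$ with $|\cdot|$ the Euclidean norm. For $p\in[1,\infty]$ and Lebesgue measurable $f:\mathbb R^d\to[0,\infty]$ let $$\|f\|_{\ell^p(L^\infty)(\mathbb R^d)}=\Big(\sum_{n\in\mathbb Z^d}\|f\|_{L^\infty(Q_n)}^p\Big)^{1/p}\in[0,\infty],$$ read as $\sup_{n}\|f\|_{L^\infty(Q_n)}$ when $p=\infty$. Theorem. Let $\ell_j:\mathbb R^d\to\mathbb R^{d_j}$, $1\le j\le N$, be surjective linear transformations, and let $p_j\in[1,\infty]$. There exists $C<\infty$ such that $$\int_{\mathbb R^d}\prod_{j=1}^N f_j(\ell_j(y))\,dy\le C\prod_{j=1}^N\|f_j\|_{\ell^{p_j}(L^\infty)(\mathbb R^{d_j})}$$ for all Lebesgue measurable functions $f_j:\mathbb R^{d_j}\to[0,\infty]$ (with the convention $0\cdot\infty=0$) if and only if for every linear subspace $V\subset\mathbb R^d$, $$\dim(V)\le\sum_{j=1}^N p_j^{-1}\dim(\ell_j(V)),$$ where $\infty^{-1}=0$.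 -/

import Mathlib

open MeasureTheory
open scoped ENNReal NNReal

noncomputable section

/-- The lattice point `n ∈ ℤ^d`, viewed in Euclidean space `ℝ^d`. -/
def latticePoint {d : ℕ} (n : Fin d → ℤ) : EuclideanSpace ℝ (Fin d) :=
  WithLp.toLp 2 fun i => (n i : ℝ)

/-- The set `Q_n = {x ∈ ℝ^d : |x - n| ≤ √d}`, with `|·|` the Euclidean norm. -/
def amalgamCell {d : ℕ} (n : Fin d → ℤ) : Set (EuclideanSpace ℝ (Fin d)) :=
  {x | ‖x - latticePoint n‖ ≤ √(d : ℝ)}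

/-- The norm of `ℓ^p(L^∞)(ℝ^d)`, with values in `[0,∞]`: the `ℓ^p` norm over `n ∈ ℤ^d` of the
essential suprema over `Q_n` (for `p = ∞`, the supremum of these). -/
def amalgamNorm {d : ℕ} (p : ℝ≥0∞) (f : EuclideanSpace ℝ (Fin d) → ℝ≥0∞) : ℝ≥0∞ :=
  eLpNorm (fun n : Fin d → ℤ => eLpNorm f ∞ (volume.restrict (amalgamCell n))) p Measure.count

end

/-! Sufficiency. A function of finite amalgam norm is dominated a.e. by `c * μ(ball) ^ (1/p)`, where
`μ` is finite and carries atoms at lattice points (`exists_measure_le_amalgamNorm`). It is therefore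
enough to bound blurred measures, a class stable under restriction, translation and push-forward.
That bound is proved by induction on `finrank ℝ E`. If a proper nonzero subspace `W` is critical,
the dimension condition passes to `W` and to the quotient by `W`, and Fubini glues the two bounds
(`HasBLBound.of_subspace`). Otherwise the exponents are moved inside the polytope cut out by the
dimension conditions. The bound is monotone in the exponents, because a ball has at most the total
mass, and it is stable under convex combinations by Hölder. So the exponents can be pushed until one
vanishes, one equals 1, or a critical subspace appears.

Necessity. Test on the indicator of a cylinder of length `R` along `V` and bounded width: its volume
grows like `R ^ dim V`, the amalgam norms on the right at most like `R ^ (dim (ℓ_j V) / p_j)`, and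
`R → ∞` compares the exponents. -/

open Metric in
/-- The Brascamp–Lieb inequality at unit scale, for measures blurred at an arbitrary scale `r`. -/
def HasBLBound {ι : Type*} [Fintype ι] {E : Type*} [AddCommGroup E] [Module ℝ E] [MeasureSpace E]
    {F : ι → Type*} [∀ j, NormedAddCommGroup (F j)] [∀ j, NormedSpace ℝ (F j)]
    [∀ j, MeasurableSpace (F j)] (L : ∀ j, E →ₗ[ℝ] F j) (t : ι → ℝ) : Prop :=
  ∀ r : ℝ, ∃ C : ℝ≥0, ∀ μ : ∀ j, Measure (F j), (∀ j, IsFiniteMeasure (μ j)) →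
    ∫⁻ y, ∏ j, μ j (closedBall (L j y) r) ^ t j ≤ C * ∏ j, μ j Set.univ ^ t j

/-! ### Stability of the blurred bound: monotonicity, convexity, slicing -/

section

variable {E : Type*} [NormedAddCommGroup E] [InnerProductSpace ℝ E] [FiniteDimensional ℝ E]
  [MeasurableSpace E] [BorelSpace E]

/-- Lebesgue measure is, up to a constant, the product of the Lebesgue measures on a subspace and
its orthogonal complement. -/
theorem exists_volume_eq_smul_map_prod (W : Submodule ℝ E) :
    ∃ c : ℝ≥0, c ≠ 0 ∧ (volume : Measure E) =
      c • ((volume : Measure W).prod (volume : Measure Wᗮ)).map fun x => (x.1 : E) + x.2 := by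
  let e : (W × Wᗮ) ≃L[ℝ] E :=
    (W.prodEquivOfIsCompl Wᗮ W.isCompl_orthogonal).toContinuousLinearEquiv
  have he : (e : W × Wᗮ → E) = fun x => (x.1 : E) + x.2 := by
    ext x; simp [e]
  rw [← he]
  have : (((volume : Measure W).prod (volume : Measure Wᗮ)).map e).IsAddHaarMeasure :=
    e.isAddHaarMeasure_map _
  refine ⟨_, ?_, Measure.isAddLeftInvariant_eq_smul volume
    (((volume : Measure W).prod (volume : Measure Wᗮ)).map e)⟩
  exact (Measure.addHaarScalarFactor_pos_of_isAddHaarMeasure _ _).ne'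

theorem measurable_measure_closedBall {α F : Type*} [MeasurableSpace α] [NormedAddCommGroup F]
    [MeasurableSpace F] [BorelSpace F] [SecondCountableTopology F] (μ : Measure F) [SFinite μ]
    {g : α → F} (hg : Measurable g) (r : ℝ) :
    Measurable fun y => μ (Metric.closedBall (g y) r) := by
  have hs : MeasurableSet {x : α × F | dist x.2 (g x.1) ≤ r} :=
    measurableSet_le (measurable_snd.dist (hg.comp measurable_fst)) measurable_const
  exact measurable_measure_prodMk_left (ν := μ) hs

variable {ι : Type*} [Fintype ι] {F : ι → Type*} [∀ j, NormedAddCommGroup (F j)]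
  [∀ j, InnerProductSpace ℝ (F j)] [∀ j, MeasurableSpace (F j)]

/-- The extra power `t j - s j` of each ball mass is absorbed by the same power of the total mass.
-/
theorem HasBLBound.mono {L : ∀ j, E →ₗ[ℝ] F j} {s t : ι → ℝ} (h : HasBLBound L s)
    (hs : ∀ j, 0 ≤ s j) (hst : ∀ j, s j ≤ t j) : HasBLBound L t := by
  intro r
  obtain ⟨C, hC⟩ := h r
  refine ⟨C, fun μ hμ => ?_⟩
  have hsplit (j : ι) (a : ℝ≥0∞) : a ^ t j = a ^ s j * a ^ (t j - s j) := by
    rw [← ENNReal.rpow_add_of_nonneg _ _ (hs j) (sub_nonneg.2 (hst j)), add_sub_cancel]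
  have hfin : ∏ j, μ j Set.univ ^ (t j - s j) ≠ ∞ :=
    ENNReal.prod_ne_top fun j _ =>
      ENNReal.rpow_ne_top_of_nonneg (sub_nonneg.2 (hst j)) (measure_ne_top _ _)
  calc ∫⁻ y, ∏ j, μ j (Metric.closedBall (L j y) r) ^ t j
      ≤ ∫⁻ y, (∏ j, μ j (Metric.closedBall (L j y) r) ^ s j) *
          ∏ j, μ j Set.univ ^ (t j - s j) := by
        refine lintegral_mono fun y => ?_
        rw [← Finset.prod_mul_distrib]
        refine Finset.prod_le_prod' fun j _ => ?_
        rw [hsplit]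
        gcongr
        · exact sub_nonneg.2 (hst j)
        · exact Set.subset_univ _
    _ ≤ (C * ∏ j, μ j Set.univ ^ s j) * ∏ j, μ j Set.univ ^ (t j - s j) := by
        rw [lintegral_mul_const' _ _ hfin]
        gcongr
        exact hC μ hμ
    _ = C * ∏ j, μ j Set.univ ^ t j := by
        rw [mul_assoc, ← Finset.prod_mul_distrib]
        simp_rw [← hsplit]

theorem hasBLBound_of_subsingleton [Subsingleton E] (L : ∀ j, E →ₗ[ℝ] F j) {t : ι → ℝ}
    (ht : ∀ j, 0 ≤ t j) : HasBLBound L t := by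
  intro r
  have : IsFiniteMeasure (volume : Measure E) :=
    ⟨(Set.subsingleton_univ.isCompact).measure_lt_top⟩
  refine ⟨(volume (Set.univ : Set E)).toNNReal, fun μ hμ => ?_⟩
  rw [ENNReal.coe_toNNReal (measure_ne_top _ _), mul_comm, ← lintegral_const]
  exact lintegral_mono fun y => Finset.prod_le_prod' fun j _ =>
    ENNReal.rpow_le_rpow (measure_mono (Set.subset_univ _)) (ht j)

variable [∀ j, FiniteDimensional ℝ (F j)] [∀ j, BorelSpace (F j)]

theorem measurable_prod_measure_closedBall (L : ∀ j, E →ₗ[ℝ] F j) (t : ι → ℝ) (r : ℝ)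
    (μ : ∀ j, Measure (F j)) [∀ j, IsFiniteMeasure (μ j)] :
    Measurable fun y => ∏ j, μ j (Metric.closedBall (L j y) r) ^ t j :=
  Finset.measurable_prod _ fun j _ =>
    (measurable_measure_closedBall (μ j)
      (LinearMap.continuous_of_finiteDimensional (L j)).measurable r).pow_const _

theorem HasBLBound.convex {L : ∀ j, E →ₗ[ℝ] F j} {s t : ι → ℝ} (h₁ : HasBLBound L s)
    (h₂ : HasBLBound L t) (hs : ∀ j, 0 ≤ s j) (ht : ∀ j, 0 ≤ t j) {a b : ℝ} (ha : 0 ≤ a)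
    (hb : 0 ≤ b) (hab : a + b = 1) : HasBLBound L fun j => a * s j + b * t j := by
  intro r
  obtain ⟨C, hC⟩ := h₁ r
  obtain ⟨D, hD⟩ := h₂ r
  refine ⟨C ^ a * D ^ b, fun μ hμ => ?_⟩
  have key (m : ι → ℝ≥0∞) : ∏ j, m j ^ (a * s j + b * t j) =
      (∏ j, m j ^ s j) ^ a * (∏ j, m j ^ t j) ^ b := by
    rw [← ENNReal.prod_rpow_of_nonneg ha, ← ENNReal.prod_rpow_of_nonneg hb,
      ← Finset.prod_mul_distrib]
    refine Finset.prod_congr rfl fun j _ => ?_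
    rw [ENNReal.rpow_add_of_nonneg _ _ (mul_nonneg ha (hs j)) (mul_nonneg hb (ht j)), mul_comm a,
      mul_comm b, ENNReal.rpow_mul, ENNReal.rpow_mul]
  simp_rw [key]
  calc _ ≤ (∫⁻ y, ∏ j, μ j (Metric.closedBall (L j y) r) ^ s j) ^ a *
        (∫⁻ y, ∏ j, μ j (Metric.closedBall (L j y) r) ^ t j) ^ b :=
      ENNReal.lintegral_mul_norm_pow_le (measurable_prod_measure_closedBall L s r μ).aemeasurable
        (measurable_prod_measure_closedBall L t r μ).aemeasurable ha hb hab
    _ ≤ (C * ∏ j, μ j Set.univ ^ s j) ^ a * (D * ∏ j, μ j Set.univ ^ t j) ^ b := by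
      gcongr
      · exact hC μ hμ
      · exact hD μ hμ
    _ = _ := by
      rw [ENNReal.mul_rpow_of_nonneg _ _ ha, ENNReal.mul_rpow_of_nonneg _ _ hb, ENNReal.coe_mul,
        ENNReal.coe_rpow_of_nonneg _ ha, ENNReal.coe_rpow_of_nonneg _ hb]
      ring

/-- All factors but the `i`-th are bounded by total masses. For the `i`-th, Fubini leaves the volume
of the points that `L i` sends within `r` of a given point, which is uniformly bounded since `L i`
is antilipschitz. -/
theorem hasBLBound_of_injective (L : ∀ j, E →ₗ[ℝ] F j) {t : ι → ℝ} (ht : ∀ j, 0 ≤ t j) {i : ι}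
    (hi : t i = 1) (hinj : Function.Injective (L i)) : HasBLBound L t := by
  classical
  intro r
  have hcont := LinearMap.continuous_of_finiteDimensional (L i)
  obtain ⟨K, -, hK⟩ := (L i).exists_antilipschitzWith (LinearMap.ker_eq_bot.2 hinj)
  obtain ⟨C, hC⟩ : ∃ C : ℝ≥0, ∀ u, volume {y : E | dist u (L i y) ≤ r} ≤ C := by
    refine ⟨(volume (Metric.closedBall (0 : E) (K * (r + r)))).toNNReal, fun u => ?_⟩
    rw [ENNReal.coe_toNNReal measure_closedBall_lt_top.ne]
    rcases Set.eq_empty_or_nonempty {y : E | dist u (L i y) ≤ r} with h | ⟨x, hx⟩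
    · simp [h]
    · rw [← Measure.addHaar_closedBall_center volume x]
      refine measure_mono fun y hy => ?_
      rw [Metric.mem_closedBall]
      refine (hK.le_mul_dist y x).trans ?_
      gcongr
      exact (dist_triangle_left _ _ u).trans (add_le_add hy hx)
  refine ⟨C, fun μ hμ => ?_⟩
  have hms : MeasurableSet {x : E × F i | dist x.2 (L i x.1) ≤ r} :=
    measurableSet_le (measurable_snd.dist (hcont.measurable.comp measurable_fst)) measurable_const
  have hfin : ∏ j ∈ Finset.univ.erase i, μ j Set.univ ^ t j ≠ ∞ :=
    ENNReal.prod_ne_top fun j _ => ENNReal.rpow_ne_top_of_nonneg (ht j) (measure_ne_top _ _)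
  have hball : ∫⁻ y, μ i (Metric.closedBall (L i y) r) ≤ C * μ i Set.univ := by
    calc ∫⁻ y, μ i (Metric.closedBall (L i y) r)
        = ((volume : Measure E).prod (μ i)) {x : E × F i | dist x.2 (L i x.1) ≤ r} := by
          rw [Measure.prod_apply hms]; rfl
      _ = ∫⁻ u, volume {y : E | dist u (L i y) ≤ r} ∂μ i := by
          rw [Measure.prod_apply_symm hms]; rfl
      _ ≤ ∫⁻ _, C ∂μ i := lintegral_mono hC
      _ = C * μ i Set.univ := lintegral_const _
  calc ∫⁻ y, ∏ j, μ j (Metric.closedBall (L j y) r) ^ t j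
      ≤ ∫⁻ y, μ i (Metric.closedBall (L i y) r) *
          ∏ j ∈ Finset.univ.erase i, μ j Set.univ ^ t j := by
        refine lintegral_mono fun y => ?_
        rw [← Finset.mul_prod_erase _ _ (Finset.mem_univ i), hi, ENNReal.rpow_one]
        gcongr with j
        · exact ht j
        · exact Set.subset_univ _
    _ ≤ C * μ i Set.univ * ∏ j ∈ Finset.univ.erase i, μ j Set.univ ^ t j := by
        rw [lintegral_mul_const' _ _ hfin]
        gcongr
    _ = C * ∏ j, μ j Set.univ ^ t j := by
        rw [mul_assoc, ← Finset.mul_prod_erase _ _ (Finset.mem_univ i), hi, ENNReal.rpow_one]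

/-- A Brascamp–Lieb bound follows from bounds on a subspace and on the corresponding quotients. -/
theorem HasBLBound.of_subspace {L : ∀ j, E →ₗ[ℝ] F j} {t : ι → ℝ} (ht : ∀ j, 0 ≤ t j)
    (W : Submodule ℝ E) (hW : HasBLBound (fun j => L j ∘ₗ W.subtype) t)
    (hQ : HasBLBound (fun j => ((W.map (L j))ᗮ.starProjection : F j →ₗ[ℝ] F j) ∘ₗ L j ∘ₗ
      Wᗮ.subtype) t) : HasBLBound L t := by
  intro r
  obtain ⟨c, -, hc⟩ := exists_volume_eq_smul_map_prod W
  obtain ⟨C, hC⟩ := hW r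
  obtain ⟨D, hD⟩ := hQ r
  refine ⟨c * (C * D), fun μ hμ => ?_⟩
  let P (j : ι) : F j →L[ℝ] F j := (W.map (L j))ᗮ.starProjection
  have hP (j : ι) (w : W) : P j (L j w) = 0 := by
    rw [Submodule.starProjection_apply_eq_zero_iff, Submodule.orthogonal_orthogonal]
    exact Submodule.mem_map_of_mem w.2
  have hmeas := measurable_prod_measure_closedBall L t r μ
  have hadd : Measurable fun x : W × Wᗮ => (x.1 : E) + x.2 := by fun_prop
  -- On the slice `W + z` only the part of `μ j` lying over the ball about `P j (L j z)` is seen.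
  -- Its total mass is a blurred value of the push-forward of `μ j` under `P j`, which is what `hQ`
  -- integrates over `z`.
  let ν (z : Wᗮ) (j : ι) : Measure (F j) :=
    ((μ j).restrict (Metric.closedBall (P j (L j z)) r |> (P j ⁻¹' ·))).map (· - L j z)
  have hν (z : Wᗮ) (j : ι) : IsFiniteMeasure (ν z j) := by infer_instance
  have hsub (z : Wᗮ) (w : W) (j : ι) :
      μ j (Metric.closedBall (L j (w + z)) r) ≤ ν z j (Metric.closedBall (L j w) r) := by
    rw [Measure.map_apply (by fun_prop) Metric.isClosed_closedBall.measurableSet,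
      Measure.restrict_apply
        ((by fun_prop : Measurable (· - L j z)) Metric.isClosed_closedBall.measurableSet)]
    refine measure_mono fun u hu => ?_
    rw [Metric.mem_closedBall, dist_eq_norm] at hu
    refine ⟨?_, ?_⟩
    · rw [Set.mem_preimage, Metric.mem_closedBall, dist_eq_norm]
      convert hu using 2
      rw [map_add]; abel
    · rw [Set.mem_preimage, Metric.mem_closedBall, dist_eq_norm]
      have : P j u - P j (L j z) = P j (u - L j (w + z)) := by
        rw [map_add, map_sub, map_add, hP, zero_add]
      rw [this]
      exact (Submodule.norm_starProjection_apply_le _ _).trans hu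
  have hνu (z : Wᗮ) (j : ι) : ν z j Set.univ =
      (μ j).map (P j) (Metric.closedBall (P j (L j z)) r) := by
    rw [Measure.map_apply (by fun_prop) MeasurableSet.univ,
      Measure.map_apply (by fun_prop) Metric.isClosed_closedBall.measurableSet]
    simp
  calc ∫⁻ y, ∏ j, μ j (Metric.closedBall (L j y) r) ^ t j
      = c * ∫⁻ z : Wᗮ, ∫⁻ w : W, ∏ j, μ j (Metric.closedBall (L j (w + z)) r) ^ t j := by
        conv_lhs => rw [hc]
        rw [lintegral_smul_measure, lintegral_map hmeas hadd]
        exact congrArg (c • ·) (lintegral_prod_symm _ (hmeas.comp hadd).aemeasurable)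
    _ ≤ c * ∫⁻ z : Wᗮ, C * ∏ j, (μ j).map (P j) (Metric.closedBall (P j (L j z)) r) ^ t j := by
        gcongr with z
        simp_rw [← hνu]
        refine le_trans ?_ (hC (ν z) (hν z))
        exact lintegral_mono fun w => Finset.prod_le_prod' fun j _ =>
          ENNReal.rpow_le_rpow (hsub z w j) (ht j)
    _ ≤ c * (C * (D * ∏ j, (μ j).map (P j) Set.univ ^ t j)) := by
        rw [lintegral_const_mul' _ _ ENNReal.coe_ne_top]
        gcongr
        exact hD (fun j => (μ j).map (P j)) fun j => inferInstance
    _ = _ := by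
        have h (j : ι) : (μ j).map (P j) Set.univ = μ j Set.univ := by
          rw [Measure.map_apply (by fun_prop) MeasurableSet.univ, Set.preimage_univ]
        simp_rw [h]
        push_cast
        ring

end

/-! ### The polytope of admissible exponents and its critical subspaces -/

/-- Follow finitely many affine functions from a point where they are nonnegative until the first
time one of the decreasing ones vanishes. -/
theorem exists_first_zero_of_affine {S : Set (ℝ × ℝ)} (hS : S.Finite) (h0 : ∀ q ∈ S, 0 ≤ q.1)
    (hneg : ∃ q ∈ S, q.2 < 0) :
    ∃ a : ℝ, 0 ≤ a ∧ (∀ q ∈ S, 0 ≤ q.1 + a * q.2) ∧ ∃ q ∈ S, q.2 < 0 ∧ q.1 + a * q.2 = 0 := by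
  obtain ⟨q, ⟨hq, hq2⟩, hmin⟩ := Set.exists_min_image {q ∈ S | q.2 < 0} (fun q => q.1 / -q.2)
    (hS.subset (Set.sep_subset _ _)) (by obtain ⟨q, h, h'⟩ := hneg; exact ⟨q, h, h'⟩)
  have ha : 0 ≤ q.1 / -q.2 := div_nonneg (h0 q hq) (by linarith)
  refine ⟨q.1 / -q.2, ha, fun x hx => ?_, q, hq, hq2, ?_⟩
  · rcases lt_or_ge x.2 0 with h | h
    · have := hmin x ⟨hx, h⟩
      rw [le_div_iff₀ (by linarith)] at this
      linarith
    · have := h0 x hx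
      positivity
  · have : q.2 ≠ 0 := hq2.ne
    field_simp
    ring

open Module

section

variable {E : Type*} [AddCommGroup E] [Module ℝ E]
  {ι : Type*} [Fintype ι] {F : ι → Type*} [∀ j, AddCommGroup (F j)] [∀ j, Module ℝ (F j)]

/-- The dimension condition, together with the constraint that the exponents lie in `[0, 1]`. -/
structure IsBLDatum (L : ∀ j, E →ₗ[ℝ] F j) (t : ι → ℝ) : Prop where
  nonneg : ∀ j, 0 ≤ t j
  le_one : ∀ j, t j ≤ 1
  finrank_le : ∀ V : Submodule ℝ E, (finrank ℝ V : ℝ) ≤ ∑ j, t j * finrank ℝ (V.map (L j))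

/-- A subspace for which equality holds in the dimension condition. -/
def IsCriticalSubspace (L : ∀ j, E →ₗ[ℝ] F j) (t : ι → ℝ) (V : Submodule ℝ E) : Prop :=
  (finrank ℝ V : ℝ) = ∑ j, t j * finrank ℝ (V.map (L j))

theorem IsBLDatum.restrict {L : ∀ j, E →ₗ[ℝ] F j} {t : ι → ℝ} (h : IsBLDatum L t)
    (W : Submodule ℝ E) : IsBLDatum (fun j => L j ∘ₗ W.subtype) t := by
  refine ⟨h.nonneg, h.le_one, fun V => ?_⟩
  have := h.finrank_le (V.map W.subtype)
  rw [Submodule.finrank_map_subtype_eq] at this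
  exact this.trans_eq (Finset.sum_congr rfl fun j _ => by rw [Submodule.map_comp])

variable [FiniteDimensional ℝ E]

theorem IsBLDatum.exists_endpoint {L : ∀ j, E →ₗ[ℝ] F j} {t : ι → ℝ} (h : IsBLDatum L t)
    (v : ι → ℝ) (hv : ∃ i, v i < 0) :
    ∃ a : ℝ, 0 ≤ a ∧ IsBLDatum L (fun j => t j + a * v j) ∧
      ((∃ i, v i < 0 ∧ t i + a * v i = 0) ∨ (∃ i, 0 < v i ∧ t i + a * v i = 1) ∨
        ∃ V : Submodule ℝ E, ∑ j, v j * finrank ℝ (V.map (L j)) < 0 ∧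
          IsCriticalSubspace L (fun j => t j + a * v j) V) := by
  classical
  -- Slack of a dimension condition and its slope along `v`. Both depend on the subspace only
  -- through a tuple of bounded dimensions, so finitely many constraints occur.
  let G : ℕ × (ι → ℕ) → ℝ × ℝ := fun m => (∑ j, t j * m.2 j - m.1, ∑ j, v j * m.2 j)
  let D : Submodule ℝ E → ℕ × (ι → ℕ) := fun V => (finrank ℝ V, fun j => finrank ℝ (V.map (L j)))
  have hD : (Set.range D).Finite := by
    refine (Set.finite_Icc (0 : ℕ × (ι → ℕ)) (finrank ℝ E, fun _ => finrank ℝ E)).subset ?_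
    rintro _ ⟨V, rfl⟩
    refine ⟨⟨Nat.zero_le _, fun j => Nat.zero_le _⟩, V.finrank_le, fun j => ?_⟩
    exact (Submodule.finrank_map_le _ _).trans V.finrank_le
  have hsum (a : ℝ) (V : Submodule ℝ E) :
      ∑ j, (t j + a * v j) * finrank ℝ (V.map (L j)) =
        ∑ j, t j * finrank ℝ (V.map (L j)) + a * ∑ j, v j * finrank ℝ (V.map (L j)) := by
    rw [Finset.mul_sum, ← Finset.sum_add_distrib]
    exact Finset.sum_congr rfl fun j _ => by ring
  obtain ⟨a, ha, hpos, q, hq, hq2, hq0⟩ := exists_first_zero_of_affine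
    (S := G '' Set.range D ∪ (Set.range (fun i => (t i, v i)) ∪
      Set.range (fun i => (1 - t i, -v i))))
    ((hD.image G).union ((Set.finite_range _).union (Set.finite_range _)))
    (by
      rintro _ (⟨_, ⟨V, rfl⟩, rfl⟩ | ⟨i, rfl⟩ | ⟨i, rfl⟩)
      · exact sub_nonneg.2 (h.finrank_le V)
      · exact h.nonneg i
      · exact sub_nonneg.2 (h.le_one i))
    (by obtain ⟨i, hi⟩ := hv; exact ⟨(t i, v i), Or.inr (Or.inl ⟨i, rfl⟩), hi⟩)
  refine ⟨a, ha, ⟨fun i => hpos _ (Or.inr (Or.inl ⟨i, rfl⟩)), fun i => ?_, fun V => ?_⟩, ?_⟩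
  · have := hpos _ (Or.inr (Or.inr ⟨i, rfl⟩))
    dsimp only at this
    linarith
  · have := hpos _ (Or.inl ⟨_, ⟨V, rfl⟩, rfl⟩)
    simp only [G, D] at this
    rw [hsum]
    linarith
  · rcases hq with ⟨_, ⟨V, rfl⟩, rfl⟩ | ⟨i, rfl⟩ | ⟨i, rfl⟩
    · refine Or.inr (Or.inr ⟨V, hq2, ?_⟩)
      simp only [G, D] at hq0
      rw [IsCriticalSubspace, hsum]
      linarith
    · exact Or.inl ⟨i, hq2, hq0⟩
    · refine Or.inr (Or.inl ⟨i, by simpa using hq2, ?_⟩)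
      dsimp only at hq0
      linarith

theorem IsBLDatum.exists_pos [Nontrivial E] {L : ∀ j, E →ₗ[ℝ] F j} {t : ι → ℝ}
    (h : IsBLDatum L t) : ∃ i, 0 < t i ∧ 0 < finrank ℝ ((⊤ : Submodule ℝ E).map (L i)) := by
  by_contra! hcon
  have h1 := h.finrank_le ⊤
  rw [Finset.sum_eq_zero, finrank_top] at h1
  · have : 0 < finrank ℝ E := finrank_pos
    exact absurd h1 (by simp [this.ne'])
  · intro j _
    rcases (h.nonneg j).eq_or_lt with h0 | h0
    · simp [← h0]
    · simp [Nat.le_zero.1 (hcon j h0)]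

/-- Passing from `⊤` to the kernel lowers the dimension by exactly the rank of `L i`, which is the
whole `i`-th term when `t i = 1`; the other terms can only decrease. -/
theorem IsBLDatum.isCriticalSubspace_ker {L : ∀ j, E →ₗ[ℝ] F j} {t : ι → ℝ} (h : IsBLDatum L t)
    (htop : IsCriticalSubspace L t ⊤) {i : ι} (hi : t i = 1) :
    IsCriticalSubspace L t (LinearMap.ker (L i)) := by
  classical
  refine le_antisymm (h.finrank_le _) ?_
  have hker : (LinearMap.ker (L i)).map (L i) = ⊥ :=
    le_bot_iff.1 (Submodule.map_le_iff_le_comap.2 le_rfl)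
  have hrn := (L i).finrank_range_add_finrank_ker
  rw [← Submodule.map_top] at hrn
  rw [IsCriticalSubspace, ← Finset.add_sum_erase _ _ (Finset.mem_univ i), hi, one_mul,
    finrank_top, ← hrn] at htop
  rw [← Finset.add_sum_erase _ _ (Finset.mem_univ i), hker, finrank_bot]
  have : ∑ j ∈ Finset.univ.erase i, t j * (finrank ℝ ((LinearMap.ker (L i)).map (L j)) : ℝ) ≤
      ∑ j ∈ Finset.univ.erase i, t j * (finrank ℝ ((⊤ : Submodule ℝ E).map (L j)) : ℝ) := by
    refine Finset.sum_le_sum fun j _ => mul_le_mul_of_nonneg_left ?_ (h.nonneg j)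
    exact_mod_cast Submodule.finrank_mono (Submodule.map_mono le_top)
  push_cast at htop
  simp only [Nat.cast_zero, mul_zero, zero_add]
  linarith

/-- The dimension condition passes to the quotient by a critical subspace `W`, here represented by a
complement `U`. -/
theorem IsBLDatum.quotient {L : ∀ j, E →ₗ[ℝ] F j} {t : ι → ℝ} (h : IsBLDatum L t)
    {W U : Submodule ℝ E} (hWU : Disjoint W U) (hW : IsCriticalSubspace L t W)
    (P : ∀ j, F j →ₗ[ℝ] F j) (hP : ∀ j, LinearMap.ker (P j) = W.map (L j)) :
    IsBLDatum (fun j => P j ∘ₗ L j ∘ₗ U.subtype) t := by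
  refine ⟨h.nonneg, h.le_one, fun V => ?_⟩
  set V' := V.map U.subtype with hV'
  have hdisj : W ⊓ V' = ⊥ :=
    (hWU.mono_right (Submodule.map_subtype_le U V)).eq_bot
  have hdim : finrank ℝ ↥(W ⊔ V') = finrank ℝ W + finrank ℝ V := by
    have := Submodule.finrank_sup_add_finrank_inf_eq W V'
    rwa [hdisj, finrank_bot, add_zero, Submodule.finrank_map_subtype_eq] at this
  have hj (j : ι) : finrank ℝ ((W ⊔ V').map (L j)) ≤
      finrank ℝ (W.map (L j)) + finrank ℝ (V.map (P j ∘ₗ L j ∘ₗ U.subtype)) := by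
    set A := (W ⊔ V').map (L j)
    have hrn := ((P j).domRestrict A).finrank_range_add_finrank_ker
    have hr : LinearMap.range ((P j).domRestrict A) = V.map (P j ∘ₗ L j ∘ₗ U.subtype) := by
      have h0 : (W.map (L j)).map (P j) = ⊥ :=
        le_bot_iff.1 (Submodule.map_le_iff_le_comap.2 (hP j).ge)
      rw [LinearMap.range_domRestrict, show A = W.map (L j) ⊔ V'.map (L j) from
        Submodule.map_sup _ _ _, Submodule.map_sup, h0, bot_sup_eq, Submodule.map_comp,
        Submodule.map_comp]
    have hk : finrank ℝ (LinearMap.ker ((P j).domRestrict A)) ≤ finrank ℝ (W.map (L j)) := by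
      rw [← hP, LinearMap.ker_domRestrict, ← Submodule.finrank_map_subtype_eq A]
      have : FiniteDimensional ℝ (LinearMap.ker (P j)) := by rw [hP]; infer_instance
      refine Submodule.finrank_mono ?_
      rintro _ ⟨x, hx, rfl⟩
      exact hx
    rw [hr] at hrn
    omega
  -- Subtracting the equality for `W` from the condition for `W ⊔ V'` leaves the condition for `V`.
  have h1 := h.finrank_le (W ⊔ V')
  have h2 : ∑ j, t j * (finrank ℝ ((W ⊔ V').map (L j)) : ℝ) ≤
      ∑ j, t j * (finrank ℝ (W.map (L j)) : ℝ) +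
        ∑ j, t j * (finrank ℝ (V.map (P j ∘ₗ L j ∘ₗ U.subtype)) : ℝ) := by
    rw [← Finset.sum_add_distrib]
    refine Finset.sum_le_sum fun j _ => ?_
    rw [← mul_add]
    exact mul_le_mul_of_nonneg_left (by exact_mod_cast hj j) (h.nonneg j)
  rw [IsCriticalSubspace] at hW
  rw [hdim] at h1
  push_cast at h1
  linarith

end

/-! ### Moving the exponents, and induction on dimension -/

section

variable {E : Type*} [NormedAddCommGroup E] [InnerProductSpace ℝ E] [FiniteDimensional ℝ E]
  [MeasurableSpace E] [BorelSpace E]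
  {ι : Type*} [Fintype ι] {F : ι → Type*} [∀ j, NormedAddCommGroup (F j)]
  [∀ j, InnerProductSpace ℝ (F j)] [∀ j, FiniteDimensional ℝ (F j)]
  [∀ j, MeasurableSpace (F j)] [∀ j, BorelSpace (F j)]

theorem hasBLBound_of_isCriticalSubspace_top_of_eq_one {L : ∀ j, E →ₗ[ℝ] F j}
    (hcrit : ∀ t, IsBLDatum L t → ∀ W, W ≠ ⊥ → W ≠ ⊤ → IsCriticalSubspace L t W → HasBLBound L t)
    {t : ι → ℝ} (h : IsBLDatum L t) (htop : IsCriticalSubspace L t ⊤) {i : ι} (hi : t i = 1)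
    (hpos : 0 < finrank ℝ ((⊤ : Submodule ℝ E).map (L i))) : HasBLBound L t := by
  by_cases hb : LinearMap.ker (L i) = ⊥
  · exact hasBLBound_of_injective L h.nonneg hi (LinearMap.ker_eq_bot.1 hb)
  · refine hcrit t h _ hb (fun ht => ?_) (h.isCriticalSubspace_ker htop hi)
    rw [LinearMap.ker_eq_top.1 ht, Submodule.map_zero, finrank_bot] at hpos
    exact lt_irrefl _ hpos

/-- Weight is traded between two exponents in both directions, keeping `⊤` critical; `t` lies
between the two endpoints reached. At each endpoint the support shrinks, an exponent is 1, or a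
proper critical subspace appears. -/
theorem hasBLBound_of_isCriticalSubspace_top [Nontrivial E] {L : ∀ j, E →ₗ[ℝ] F j}
    (hcrit : ∀ t, IsBLDatum L t → ∀ W, W ≠ ⊥ → W ≠ ⊤ → IsCriticalSubspace L t W → HasBLBound L t)
    (n : ℕ) (t : ι → ℝ) (hn : {j | t j ≠ 0}.ncard = n) (h : IsBLDatum L t)
    (htop : IsCriticalSubspace L t ⊤) : HasBLBound L t := by
  classical
  induction n using Nat.strong_induction_on generalizing t with
  | _ n ih =>
  set d : ι → ℝ := fun j => finrank ℝ ((⊤ : Submodule ℝ E).map (L j)) with hd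
  obtain ⟨i, hti, hdi⟩ := h.exists_pos
  rcases (h.le_one i).eq_or_lt with h1 | h1
  · exact hasBLBound_of_isCriticalSubspace_top_of_eq_one hcrit h htop h1 hdi
  have hdi' : 0 < d i := Nat.cast_pos.2 hdi
  -- If `i` alone contributed, then `dim E = t i * d i < d i ≤ dim E`.
  obtain ⟨j, hji, hj⟩ : ∃ j, j ≠ i ∧ t j * d j ≠ 0 := by
    by_contra! hcon
    have h2 : (finrank ℝ (⊤ : Submodule ℝ E) : ℝ) = t i * d i := by
      rw [htop]
      exact Finset.sum_eq_single i (fun j _ hj => hcon j hj) (by simp)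
    have h3 : d i ≤ finrank ℝ (⊤ : Submodule ℝ E) := by
      exact Nat.cast_le.2 (Submodule.finrank_map_le (L i) ⊤)
    nlinarith
  have htj : 0 < t j := (h.nonneg j).lt_of_ne (left_ne_zero_of_mul hj).symm
  have hdj' : 0 < d j := (Nat.cast_nonneg _).lt_of_ne (right_ne_zero_of_mul hj).symm
  have endpoint (i j : ι) (hij : i ≠ j) (hti : 0 < t i) (htj : 0 < t j) (hdi : 0 < d i)
      (hdj : 0 < d j) : ∃ a : ℝ, 0 ≤ a ∧
        IsBLDatum L (fun k => t k + a * ((Pi.single i (d i)⁻¹ : ι → ℝ) k - (Pi.single j (d j)⁻¹ : ι → ℝ) k)) ∧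
        HasBLBound L (fun k => t k + a * ((Pi.single i (d i)⁻¹ : ι → ℝ) k - (Pi.single j (d j)⁻¹ : ι → ℝ) k)) := by
    -- The weights make `∑ k, v k * d k = 0`, so equality at `⊤` persists along the path and `⊤`
    -- cannot be the new critical subspace.
    set v : ι → ℝ := fun k =>
      (Pi.single i (d i)⁻¹ : ι → ℝ) k - (Pi.single j (d j)⁻¹ : ι → ℝ) k with hv
    have hvi : v i = (d i)⁻¹ := by simp [hv, hij]
    have hvj : v j = -(d j)⁻¹ := by simp [hv, hij.symm]
    have hvk (k : ι) (h1 : k ≠ i) (h2 : k ≠ j) : v k = 0 := by simp [hv, h1, h2]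
    have hvd : ∑ k, v k * d k = 0 := by
      simp only [hv, sub_mul, Finset.sum_sub_distrib, Pi.single_apply, ite_mul, zero_mul,
        Finset.sum_ite_eq', Finset.mem_univ, if_true]
      rw [inv_mul_cancel₀ hdi.ne', inv_mul_cancel₀ hdj.ne', sub_self]
    obtain ⟨a, ha, h', hcases⟩ := h.exists_endpoint v
      ⟨j, by rw [hvj]; exact neg_neg_of_pos (inv_pos.2 hdj)⟩
    have htop' : IsCriticalSubspace L (fun k => t k + a * v k) ⊤ := by
      rw [IsCriticalSubspace, htop]
      calc ∑ k, t k * d k = ∑ k, t k * d k + a * ∑ k, v k * d k := by rw [hvd]; ring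
        _ = ∑ k, (t k + a * v k) * d k := by
          rw [Finset.mul_sum, ← Finset.sum_add_distrib]
          exact Finset.sum_congr rfl fun k _ => by ring
    refine ⟨a, ha, h', ?_⟩
    rcases hcases with ⟨k, hk, hk0⟩ | ⟨k, hk, hk1⟩ | ⟨V, hV, hVc⟩
    · obtain rfl : k = j := by
        by_contra hkj
        by_cases hki : k = i
        · rw [hki, hvi] at hk; exact absurd hk (inv_pos.2 hdi).not_gt
        · rw [hvk k hki hkj] at hk; exact lt_irrefl _ hk
      refine ih _ ?_ _ rfl h' htop'
      rw [← hn]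
      refine Set.ncard_lt_ncard ⟨fun l hl => ?_, fun hsub => hsub htj.ne' hk0⟩ (Set.toFinite _)
      rcases eq_or_ne l i with rfl | hli
      · exact hti.ne'
      · rcases eq_or_ne l k with rfl | hlk
        · exact htj.ne'
        · have hl : t l + a * v l ≠ 0 := hl
          rwa [hvk l hli hlk, mul_zero, add_zero] at hl
    · obtain rfl : k = i := by
        by_contra hki
        by_cases hkj : k = j
        · rw [hkj, hvj] at hk; have := inv_pos.2 hdj; linarith
        · rw [hvk k hki hkj] at hk; exact lt_irrefl _ hk
      exact hasBLBound_of_isCriticalSubspace_top_of_eq_one hcrit h' htop' hk1 (Nat.cast_pos.1 hdi)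
    · refine hcrit _ h' V ?_ ?_ hVc
      · rintro rfl
        exact hV.ne (Finset.sum_eq_zero fun j _ => by
          rw [Submodule.map_bot, finrank_bot, Nat.cast_zero, mul_zero])
      · rintro rfl
        exact hV.ne hvd
  obtain ⟨a, ha, ha', hA⟩ := endpoint i j hji.symm hti htj hdi' hdj'
  obtain ⟨b, hb, hb', hB⟩ := endpoint j i hji htj hti hdj' hdi'
  rcases (add_nonneg ha hb).eq_or_lt with h0 | h0
  · obtain rfl : a = 0 := by linarith
    simpa using hA
  · convert hA.convex hB ha'.nonneg hb'.nonneg (a := b / (a + b)) (b := a / (a + b))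
      (by positivity) (by positivity) (by field_simp; ring) using 2 with k
    field_simp
    ring

/-- By monotonicity a positive exponent may be lowered until it vanishes or some subspace, possibly
`⊤`, becomes critical. -/
theorem hasBLBound_of_critical [Nontrivial E] {L : ∀ j, E →ₗ[ℝ] F j}
    (hcrit : ∀ t, IsBLDatum L t → ∀ W, W ≠ ⊥ → W ≠ ⊤ → IsCriticalSubspace L t W → HasBLBound L t)
    (n : ℕ) (t : ι → ℝ) (hn : {j | t j ≠ 0}.ncard = n) (h : IsBLDatum L t) : HasBLBound L t := by
  classical
  induction n using Nat.strong_induction_on generalizing t with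
  | _ n ih =>
  obtain ⟨i, hti, -⟩ := h.exists_pos
  set v : ι → ℝ := Pi.single i (-1) with hv
  have hvi : v i = -1 := by simp [hv]
  have hvk (k : ι) (h1 : k ≠ i) : v k = 0 := by simp [hv, h1]
  have hvle (k : ι) : v k ≤ 0 := by
    rcases eq_or_ne k i with rfl | hk
    · rw [hvi]; norm_num
    · exact (hvk k hk).le
  obtain ⟨a, ha, h', hcases⟩ := h.exists_endpoint v ⟨i, by rw [hvi]; norm_num⟩
  refine HasBLBound.mono (s := fun k => t k + a * v k) ?_ h'.nonneg
    fun k => by nlinarith [hvle k]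
  rcases hcases with ⟨k, hk, hk0⟩ | ⟨k, hk, hk1⟩ | ⟨V, hV, hVc⟩
  · obtain rfl : k = i := by
      by_contra hki
      exact hk.ne (hvk k hki)
    refine ih _ ?_ _ rfl h'
    rw [← hn]
    refine Set.ncard_lt_ncard ⟨fun l hl => ?_, fun hsub => hsub hti.ne' hk0⟩ (Set.toFinite _)
    rcases eq_or_ne l k with rfl | hlk
    · exact hti.ne'
    · simpa [hvk l hlk] using hl
  · exact absurd hk (hvle k).not_gt
  · by_cases hVt : V = ⊤
    · subst hVt
      exact hasBLBound_of_isCriticalSubspace_top hcrit _ _ rfl h' hVc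
    · refine hcrit _ h' V ?_ hVt hVc
      rintro rfl
      exact hV.ne (Finset.sum_eq_zero fun j _ => by
        rw [Submodule.map_bot, finrank_bot, Nat.cast_zero, mul_zero])

end

universe u

/-- The dimension condition suffices for the Brascamp–Lieb bound. -/
theorem IsBLDatum.hasBLBound {ι : Type*} [Fintype ι] {F : ι → Type*}
    [∀ j, NormedAddCommGroup (F j)] [∀ j, InnerProductSpace ℝ (F j)]
    [∀ j, FiniteDimensional ℝ (F j)] [∀ j, MeasurableSpace (F j)] [∀ j, BorelSpace (F j)]
    (n : ℕ) : ∀ {E : Type u} [NormedAddCommGroup E] [InnerProductSpace ℝ E]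
    [FiniteDimensional ℝ E] [MeasurableSpace E] [BorelSpace E] (_ : finrank ℝ E = n)
    {L : ∀ j, E →ₗ[ℝ] F j} {t : ι → ℝ} (_ : IsBLDatum L t), HasBLBound L t := by
  induction n using Nat.strong_induction_on with
  | _ n ih =>
  intro E _ _ _ _ _ hn L t h
  rcases subsingleton_or_nontrivial E with hE | hE
  · exact hasBLBound_of_subsingleton L h.nonneg
  refine hasBLBound_of_critical (fun t h W hbot htop hW => ?_) _ t rfl h
  have hadd := W.finrank_add_finrank_orthogonal
  have hlt := Submodule.finrank_lt htop
  have hpos : 0 < finrank ℝ W := Nat.pos_of_ne_zero fun h0 => hbot (Submodule.finrank_eq_zero.1 h0)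
  refine HasBLBound.of_subspace h.nonneg W (ih _ (by omega) rfl (h.restrict W))
    (ih _ (by omega) rfl (h.quotient W.orthogonal_disjoint hW _ fun j => ?_))
  rw [Submodule.ker_starProjection, Submodule.orthogonal_orthogonal]

/-! ### From amalgam norms to blurred measures -/

theorem exists_mem_amalgamCell {d : ℕ} (x : EuclideanSpace ℝ (Fin d)) :
    ∃ n : Fin d → ℤ, x ∈ amalgamCell n := by
  refine ⟨fun i => round (x i), ?_⟩
  rw [amalgamCell, Set.mem_ofPred_eq, EuclideanSpace.norm_eq]
  refine Real.sqrt_le_sqrt ?_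
  calc ∑ i, ‖(x - latticePoint fun i => round (x i)) i‖ ^ 2 ≤ ∑ _i : Fin d, (1 : ℝ) := by
        refine Finset.sum_le_sum fun i _ => pow_le_one₀ (norm_nonneg _) ?_
        have := abs_sub_round (x i)
        simp only [latticePoint, PiLp.sub_apply, Real.norm_eq_abs]
        linarith
    _ = d := by simp

theorem measurableSet_amalgamCell {d : ℕ} (n : Fin d → ℤ) : MeasurableSet (amalgamCell n) :=
  measurableSet_le (by fun_prop) measurable_const

theorem ae_le_eLpNorm_amalgamCell {d : ℕ} (f : EuclideanSpace ℝ (Fin d) → ℝ≥0∞) :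
    ∀ᵐ x, ∀ n : Fin d → ℤ, x ∈ amalgamCell n →
      f x ≤ eLpNorm f ∞ (volume.restrict (amalgamCell n)) := by
  rw [ae_all_iff]
  intro n
  rw [← ae_restrict_iff' (measurableSet_amalgamCell n), eLpNorm_exponent_top]
  filter_upwards [enorm_ae_le_eLpNormEssSup f (volume.restrict (amalgamCell n))] with x hx
  simpa using hx

/-- A function of finite amalgam norm is dominated by a blurred finite measure. -/
theorem exists_measure_le_amalgamNorm {d : ℕ} {p : ℝ≥0∞} (hp : 1 ≤ p)
    (f : EuclideanSpace ℝ (Fin d) → ℝ≥0∞) (hf : amalgamNorm p f ≠ ∞) :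
    ∃ (c : ℝ≥0) (μ : Measure (EuclideanSpace ℝ (Fin d))), IsFiniteMeasure μ ∧
      (∀ᵐ x, f x ≤ c * μ (Metric.closedBall x √(d : ℝ)) ^ p⁻¹.toReal) ∧
      c * μ Set.univ ^ p⁻¹.toReal ≤ amalgamNorm p f := by
  set a : (Fin d → ℤ) → ℝ≥0∞ := fun n => eLpNorm f ∞ (volume.restrict (amalgamCell n)) with ha
  rcases eq_or_ne p ∞ with rfl | hp'
  -- The exponent is 0 and `0 ^ 0 = 1`, so the constant alone carries the norm.
  · refine ⟨(amalgamNorm ∞ f).toNNReal, 0, inferInstance, ?_, ?_⟩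
    · filter_upwards [ae_le_eLpNorm_amalgamCell f] with x hx
      obtain ⟨n, hn⟩ := exists_mem_amalgamCell x
      rw [ENNReal.coe_toNNReal hf]
      simp only [ENNReal.inv_top, ENNReal.toReal_zero, ENNReal.rpow_zero, mul_one]
      refine (hx n hn).trans ?_
      have h := enorm_ae_le_eLpNormEssSup a Measure.count
      rw [Measure.ae_count_iff] at h
      simpa [amalgamNorm, ha] using h n
    · rw [ENNReal.coe_toNNReal hf]
      simp
  · have hp0 : 0 < p.toReal := ENNReal.toReal_pos (by positivity) hp'
    have hA : amalgamNorm p f = (∑' n, a n ^ p.toReal) ^ p⁻¹.toReal := by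
      rw [amalgamNorm, eLpNorm_eq_lintegral_rpow_enorm_toReal (by positivity) hp', lintegral_count,
        ENNReal.toReal_inv, one_div]
      rfl
    let μ : Measure (EuclideanSpace ℝ (Fin d)) :=
      Measure.sum fun n => a n ^ p.toReal • Measure.dirac (latticePoint n)
    have hμ : μ Set.univ = ∑' n, a n ^ p.toReal := by
      rw [Measure.sum_apply _ MeasurableSet.univ]
      simp
    have ht : 0 < p⁻¹.toReal := by rw [ENNReal.toReal_inv]; positivity
    refine ⟨1, μ, ⟨?_⟩, ?_, by rw [hμ, hA, ENNReal.coe_one, one_mul]⟩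
    · rw [hA, Ne, ENNReal.rpow_eq_top_iff_of_pos ht] at hf
      rw [hμ]
      exact lt_top_iff_ne_top.2 hf
    · filter_upwards [ae_le_eLpNorm_amalgamCell f] with x hx
      obtain ⟨n, hn⟩ := exists_mem_amalgamCell x
      have hmem : latticePoint n ∈ Metric.closedBall x √(d : ℝ) := by
        rw [Metric.mem_closedBall, dist_comm, dist_eq_norm]
        exact hn
      have hball : a n ^ p.toReal ≤ μ (Metric.closedBall x √(d : ℝ)) := by
        rw [Measure.sum_apply _ Metric.isClosed_closedBall.measurableSet]
        refine le_trans ?_ (ENNReal.le_tsum n)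
        simp [Measure.dirac_apply' _ Metric.isClosed_closedBall.measurableSet, hmem]
      calc f x ≤ a n := hx n hn
        _ = (a n ^ p.toReal) ^ p⁻¹.toReal := by
          rw [ENNReal.toReal_inv, ENNReal.rpow_rpow_inv hp0.ne']
        _ ≤ _ := by
          rw [ENNReal.coe_one, one_mul]
          gcongr

section

variable {N d : ℕ} {dj : Fin N → ℕ}
  {ℓ : (j : Fin N) → EuclideanSpace ℝ (Fin d) →ₗ[ℝ] EuclideanSpace ℝ (Fin (dj j))}

theorem ae_comp_of_surjective {d k : ℕ}
    {l : EuclideanSpace ℝ (Fin d) →ₗ[ℝ] EuclideanSpace ℝ (Fin k)} (hl : Function.Surjective l)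
    {P : EuclideanSpace ℝ (Fin k) → Prop} (h : ∀ᵐ x, P x) : ∀ᵐ y, P (l y) := by
  obtain ⟨s, hs, hms, hs0⟩ := exists_measurable_superset_of_null h
  have := (ae_comp_linearMap_mem_iff l volume volume hl hms.compl).2 (measure_eq_zero_iff_ae_notMem.1 hs0)
  filter_upwards [this] with y hy
  by_contra hc
  exact hy (hs hc)

/-- The bound for blurred measures implies the bound in terms of amalgam norms. -/
theorem HasBLBound.exists_lintegral_le_amalgamNorm (hℓ : ∀ j, Function.Surjective (ℓ j))
    {p : Fin N → ℝ≥0∞} (hp : ∀ j, 1 ≤ p j) (h : HasBLBound ℓ fun j => (p j)⁻¹.toReal) :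
    ∃ C : ℝ≥0, ∀ f : (j : Fin N) → EuclideanSpace ℝ (Fin (dj j)) → ℝ≥0∞,
      ∫⁻ y, ∏ j, f j (ℓ j y) ≤ (C : ℝ≥0∞) * ∏ j, amalgamNorm (p j) (f j) := by
  obtain ⟨C, hC⟩ := h (∑ j, √(dj j : ℝ))
  -- A nonzero constant keeps the right side infinite when some norm is `∞` and none is 0.
  refine ⟨C + 1, fun f => ?_⟩
  by_cases hzero : ∃ j, amalgamNorm (p j) (f j) = 0
  · obtain ⟨j, hj⟩ := hzero
    obtain ⟨c, μ, -, hle, hμ⟩ := exists_measure_le_amalgamNorm (hp j) (f j) (by simp [hj])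
    refine le_of_eq_of_le ?_ zero_le
    rw [← lintegral_zero]
    refine lintegral_congr_ae ?_
    filter_upwards [ae_comp_of_surjective (hℓ j) hle] with y hy
    refine Finset.prod_eq_zero (Finset.mem_univ j) (le_antisymm ?_ zero_le)
    rw [hj] at hμ
    refine hy.trans (le_trans ?_ hμ)
    gcongr
    exact Set.subset_univ _
  by_cases htop : ∃ j, amalgamNorm (p j) (f j) = ∞
  · obtain ⟨j, hj⟩ := htop
    have : ∏ j, amalgamNorm (p j) (f j) = ∞ := by
      rw [← Finset.mul_prod_erase _ _ (Finset.mem_univ j), hj, ENNReal.top_mul]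
      exact Finset.prod_ne_zero_iff.2 fun i _ hi => hzero ⟨i, hi⟩
    rw [this, ENNReal.mul_top (by simp)]
    exact le_top
  push Not at htop
  choose c μ hfin hle hμ using fun j => exists_measure_le_amalgamNorm (hp j) (f j) (htop j)
  have hae : ∀ᵐ y, ∀ j, f j (ℓ j y) ≤
      c j * μ j (Metric.closedBall (ℓ j y) √(dj j : ℝ)) ^ (p j)⁻¹.toReal :=
    ae_all_iff.2 fun j => ae_comp_of_surjective (hℓ j) (hle j)
  calc ∫⁻ y, ∏ j, f j (ℓ j y)
      ≤ ∫⁻ y, (∏ j, (c j : ℝ≥0∞)) *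
          ∏ j, μ j (Metric.closedBall (ℓ j y) (∑ j, √(dj j : ℝ))) ^ (p j)⁻¹.toReal := by
        refine lintegral_mono_ae ?_
        filter_upwards [hae] with y hy
        rw [← Finset.prod_mul_distrib]
        refine Finset.prod_le_prod' fun j _ => (hy j).trans ?_
        gcongr
        exact Finset.single_le_sum (f := fun j => √(dj j : ℝ)) (fun j _ => Real.sqrt_nonneg _)
          (Finset.mem_univ j)
    _ ≤ (∏ j, (c j : ℝ≥0∞)) * (C * ∏ j, μ j Set.univ ^ (p j)⁻¹.toReal) := by
        rw [lintegral_const_mul' _ _ (ENNReal.prod_ne_top fun j _ => ENNReal.coe_ne_top)]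
        gcongr
        exact hC μ hfin
    _ = C * ∏ j, (c j * μ j Set.univ ^ (p j)⁻¹.toReal) := by
        rw [Finset.prod_mul_distrib]
        ring
    _ ≤ (C + 1 : ℝ≥0) * ∏ j, amalgamNorm (p j) (f j) := by
        gcongr with j
        · exact le_self_add
        · exact hμ j

end

/-! ### Necessity: testing on cylinders -/

section

variable {E : Type*} [NormedAddCommGroup E] [InnerProductSpace ℝ E] [FiniteDimensional ℝ E]

/-- The cylinder of points whose components along `U` and `Uᗮ` have norm at most `a` and `b`. -/
def Submodule.cylinder (U : Submodule ℝ E) (a b : ℝ) : Set E :=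
  {x | ‖U.starProjection x‖ ≤ a ∧ ‖Uᗮ.starProjection x‖ ≤ b}

theorem Submodule.add_mem_cylinder {U : Submodule ℝ E} {a b r : ℝ} {x y : E}
    (hx : x ∈ U.cylinder a b) (hy : ‖y‖ ≤ r) : x + y ∈ U.cylinder (a + r) (b + r) := by
  constructor <;> rw [map_add] <;> refine (norm_add_le _ _).trans (add_le_add ?_ ?_)
  · exact hx.1
  · exact (U.norm_starProjection_apply_le y).trans hy
  · exact hx.2
  · exact (Uᗮ.norm_starProjection_apply_le y).trans hy

theorem Submodule.cylinder_mono (U : Submodule ℝ E) {a b a' b' : ℝ} (ha : a ≤ a') (hb : b ≤ b') :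
    U.cylinder a b ⊆ U.cylinder a' b' :=
  fun _ hx => ⟨hx.1.trans ha, hx.2.trans hb⟩

/-- Projecting off `V.map L` kills the image of the long component, so the width stays bounded
independently of `R`. -/
theorem LinearMap.map_mem_cylinder {F : Type*} [NormedAddCommGroup F] [InnerProductSpace ℝ F]
    [FiniteDimensional ℝ F] (L : E →ₗ[ℝ] F) (V : Submodule ℝ E) :
    ∃ K : ℝ, 0 ≤ K ∧ ∀ R : ℝ, 1 ≤ R → ∀ y ∈ V.cylinder R 1, L y ∈ (V.map L).cylinder (K * R) K := by
  set T := LinearMap.toContinuousLinearMap L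
  refine ⟨‖T‖ * 2, by positivity, fun R hR y hy => ?_⟩
  have hsplit : L y = L (V.starProjection y) + L (Vᗮ.starProjection y) := by
    rw [← map_add, Submodule.starProjection_add_starProjection_orthogonal]
  have hT (z : E) : ‖L z‖ ≤ ‖T‖ * ‖z‖ := T.le_opNorm z
  have h1 : ‖L (V.starProjection y)‖ ≤ ‖T‖ * R :=
    (hT _).trans (mul_le_mul_of_nonneg_left hy.1 (norm_nonneg _))
  have h2 : ‖L (Vᗮ.starProjection y)‖ ≤ ‖T‖ * 1 :=
    (hT _).trans (mul_le_mul_of_nonneg_left hy.2 (norm_nonneg _))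
  have h3 := mul_le_mul_of_nonneg_left hR (norm_nonneg T)
  constructor
  · refine (Submodule.norm_starProjection_apply_le _ _).trans ?_
    rw [hsplit]
    refine (norm_add_le _ _).trans ?_
    linarith
  · have h0 : (V.map L)ᗮ.starProjection (L (V.starProjection y)) = 0 := by
      rw [Submodule.starProjection_apply_eq_zero_iff, Submodule.orthogonal_orthogonal]
      exact Submodule.mem_map_of_mem (V.starProjection_apply_mem y)
    rw [hsplit, map_add, h0, zero_add]
    refine (Submodule.norm_starProjection_apply_le _ _).trans (h2.trans ?_)
    linarith [norm_nonneg T]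

variable [MeasurableSpace E] [BorelSpace E]

theorem Submodule.measurableSet_cylinder (U : Submodule ℝ E) (a b : ℝ) :
    MeasurableSet (U.cylinder a b) :=
  (measurableSet_le (f := fun x => ‖U.starProjection x‖) (by fun_prop) measurable_const).inter
    (measurableSet_le (f := fun x => ‖Uᗮ.starProjection x‖) (by fun_prop) measurable_const)

theorem Submodule.exists_volume_cylinder (U : Submodule ℝ E) {b : ℝ} (hb : 0 < b) :
    ∃ c : ℝ≥0, c ≠ 0 ∧ ∀ a : ℝ, 0 ≤ a →
      volume (U.cylinder a b) = c * ENNReal.ofReal a ^ finrank ℝ U := by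
  obtain ⟨c, hc0, hc⟩ := exists_volume_eq_smul_map_prod U
  have hball : volume (Metric.ball (0 : U) 1) ≠ ∞ := measure_ball_lt_top.ne
  have hball' : volume (Metric.closedBall (0 : Uᗮ) b) ≠ ∞ := measure_closedBall_lt_top.ne
  refine ⟨c * ((volume (Metric.ball (0 : U) 1)).toNNReal *
    (volume (Metric.closedBall (0 : Uᗮ) b)).toNNReal), ?_, fun a ha => ?_⟩
  · refine mul_ne_zero hc0 (mul_ne_zero ?_ ?_)
    · exact ENNReal.toNNReal_ne_zero.2 ⟨(Metric.measure_ball_pos _ _ one_pos).ne', hball⟩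
    · exact ENNReal.toNNReal_ne_zero.2 ⟨(Metric.measure_closedBall_pos _ _ hb).ne', hball'⟩
  · have hpre : (fun x : U × Uᗮ => (x.1 : E) + x.2) ⁻¹' U.cylinder a b =
        Metric.closedBall 0 a ×ˢ Metric.closedBall 0 b := by
      ext ⟨w, z⟩
      have h1 : U.starProjection ((w : E) + z) = w := by
        rw [map_add, U.starProjection_mem_subspace_eq_self,
          U.starProjection_apply_eq_zero_iff.2 z.2, add_zero]
      have h2 : Uᗮ.starProjection ((w : E) + z) = z := by
        rw [map_add, Uᗮ.starProjection_mem_subspace_eq_self,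
          Uᗮ.starProjection_apply_eq_zero_iff.2 (U.le_orthogonal_orthogonal w.2), zero_add]
      simp only [Submodule.cylinder, Set.mem_preimage, Set.mem_ofPred_eq, h1, h2, Set.mem_prod,
        mem_closedBall_zero_iff, Submodule.coe_norm]
    conv_lhs => rw [hc]
    rw [Measure.smul_apply, Measure.map_apply (by fun_prop) (U.measurableSet_cylinder a b), hpre, Measure.prod_prod,
      Measure.addHaar_closedBall _ _ ha, ENNReal.ofReal_pow ha]
    push_cast
    rw [ENNReal.coe_toNNReal hball, ENNReal.coe_toNNReal hball', ENNReal.smul_def, smul_eq_mul]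
    ring

end

theorem one_le_dist_latticePoint {d : ℕ} {m n : Fin d → ℤ} (h : m ≠ n) :
    1 ≤ dist (latticePoint m) (latticePoint n) := by
  obtain ⟨i, hi⟩ := Function.ne_iff.1 h
  rw [dist_eq_norm]
  refine le_trans ?_ (PiLp.norm_apply_le (latticePoint m - latticePoint n) i)
  simp only [latticePoint, PiLp.sub_apply, Real.norm_eq_abs]
  exact_mod_cast Int.one_le_abs (sub_ne_zero.2 hi)

/-- The number of lattice points in a set is controlled by the volume of a neighbourhood. -/
theorem count_latticePoint_mul_volume_ball_le {d : ℕ} (S : Set (Fin d → ℤ))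
    (T : Set (EuclideanSpace ℝ (Fin d)))
    (h : ∀ n ∈ S, Metric.ball (latticePoint n) (1 / 2) ⊆ T) :
    Measure.count S * volume (Metric.ball (0 : EuclideanSpace ℝ (Fin d)) (1 / 2)) ≤ volume T := by
  have hdisj : Pairwise (Function.onFun Disjoint
      fun n : S => Metric.ball (latticePoint (n : Fin d → ℤ)) (1 / 2)) := by
    intro m n hmn
    refine Metric.ball_disjoint_ball ?_
    have := one_le_dist_latticePoint (Subtype.coe_ne_coe.2 hmn)
    linarith
  have h1 := tsum_meas_le_meas_iUnion_of_disjoint volume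
    (fun n : S => (Metric.isOpen_ball (x := latticePoint (n : Fin d → ℤ)) (ε := 1 / 2)).measurableSet)
    hdisj
  refine le_trans (le_of_eq ?_) (h1.trans (measure_mono (Set.iUnion_subset fun n => h n n.2)))
  simp_rw [Measure.addHaar_ball_center]
  rw [ENNReal.tsum_const, Measure.count_apply (Set.to_countable S).measurableSet]
  rfl

/-- The norm is at most the number of cells meeting the cylinder, to the power `1/p`; disjoint
half-unit balls about their centres compare that number with a volume. -/
theorem exists_amalgamNorm_indicator_cylinder_le {d : ℕ} (p : ℝ≥0∞)
    (U : Submodule ℝ (EuclideanSpace ℝ (Fin d))) {K : ℝ} (hK : 0 ≤ K) :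
    ∃ D : ℝ≥0, ∀ R : ℝ, 1 ≤ R →
      amalgamNorm p ((U.cylinder (K * R) K).indicator fun _ => (1 : ℝ≥0∞)) ≤
        (D * ENNReal.ofReal R ^ finrank ℝ U) ^ p⁻¹.toReal := by
  -- Cell radius plus ball radius, added to the width.
  set M : ℝ := K + √(d : ℝ) + 1 / 2 with hM
  have hM0 : 0 < M := by positivity
  obtain ⟨c, -, hc⟩ := U.exists_volume_cylinder hM0
  set β := volume (Metric.ball (0 : EuclideanSpace ℝ (Fin d)) (1 / 2)) with hβ
  have hβ0 : β ≠ 0 := (Metric.measure_ball_pos _ _ (by norm_num)).ne'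
  have hβt : β ≠ ∞ := measure_ball_lt_top.ne
  refine ⟨c * M.toNNReal ^ finrank ℝ U / β.toNNReal, fun R hR => ?_⟩
  set T := U.cylinder (K * R) K with hT
  set S : Set (Fin d → ℤ) := {n | (amalgamCell n ∩ T).Nonempty} with hS
  have hcount : Measure.count S ≤
      ((c * M.toNNReal ^ finrank ℝ U / β.toNNReal : ℝ≥0) : ℝ≥0∞) *
        ENNReal.ofReal R ^ finrank ℝ U := by
    have h1 : Measure.count S * β ≤ volume (U.cylinder (M * R) M) := by
      refine count_latticePoint_mul_volume_ball_le S _ fun n hn z hz => ?_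
      obtain ⟨x, hxn, hxT⟩ := hn
      have hzx : ‖z - x‖ ≤ √(d : ℝ) + 1 / 2 := by
        have h2 : ‖x - latticePoint n‖ ≤ √(d : ℝ) := hxn
        rw [Metric.mem_ball, dist_eq_norm] at hz
        have := norm_sub_le_norm_sub_add_norm_sub z (latticePoint n) x
        rw [norm_sub_rev (latticePoint n) x] at this
        linarith
      have := Submodule.add_mem_cylinder hxT hzx
      rw [add_sub_cancel] at this
      refine U.cylinder_mono ?_ (by rw [hM]; linarith) this
      have h3 : (√(d : ℝ) + 1 / 2) * 1 ≤ (√(d : ℝ) + 1 / 2) * R :=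
        mul_le_mul_of_nonneg_left hR (by positivity)
      rw [hM]
      linarith
    rw [hc _ (by positivity), ENNReal.ofReal_mul hM0.le, mul_pow] at h1
    rw [← ENNReal.le_div_iff_mul_le (Or.inl hβ0) (Or.inl hβt)] at h1
    refine h1.trans (le_of_eq ?_)
    rw [ENNReal.coe_div (ENNReal.toNNReal_ne_zero.2 ⟨hβ0, hβt⟩), ENNReal.coe_toNNReal hβt]
    push_cast
    rw [ENNReal.ofReal, ENNReal.div_eq_inv_mul, ENNReal.div_eq_inv_mul]
    ring
  calc amalgamNorm p (T.indicator fun _ => (1 : ℝ≥0∞))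
      ≤ eLpNorm (S.indicator fun _ => (1 : ℝ≥0∞)) p Measure.count := by
        refine eLpNorm_mono_enorm fun n => ?_
        by_cases hn : n ∈ S
        · rw [Set.indicator_of_mem hn]
          simpa using eLpNorm_indicator_const_le (c := (1 : ℝ≥0∞)) (s := T)
            (μ := volume.restrict (amalgamCell n)) ∞
        · have h0 : eLpNorm (T.indicator fun _ => (1 : ℝ≥0∞)) ∞
              (volume.restrict (amalgamCell n)) = 0 := by
            rw [← eLpNorm_zero (ε := ℝ≥0∞) (p := ∞) (μ := volume.restrict (amalgamCell n))]
            refine eLpNorm_congr_ae ((ae_restrict_iff' (measurableSet_amalgamCell n)).2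
              (Filter.Eventually.of_forall fun x hx => ?_))
            exact Set.indicator_of_notMem (fun hxT => hn ⟨x, hx, hxT⟩) _
          rw [h0]
          simp
    _ ≤ ‖(1 : ℝ≥0∞)‖ₑ * Measure.count S ^ (1 / p.toReal) := eLpNorm_indicator_const_le _ p
    _ ≤ _ := by
        rw [ENNReal.toReal_inv, one_div, enorm_eq_self, one_mul]
        gcongr

theorem le_of_forall_rpow_le_mul {a b : ℝ} {C : ℝ} (h : ∀ R : ℝ, 1 ≤ R → R ^ a ≤ C * R ^ b) :
    a ≤ b := by
  by_contra! hab
  have ht := tendsto_rpow_atTop (sub_pos.2 hab)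
  obtain ⟨R, hR, hR1⟩ := ((ht.eventually_gt_atTop C).and (Filter.eventually_ge_atTop 1)).exists
  have hR0 : 0 < R := by linarith
  have := h R hR1
  rw [Real.rpow_sub hR0, lt_div_iff₀ (by positivity)] at hR
  linarith

/-- Testing the inequality on indicators of cylinders gives the dimension condition. -/
theorem finrank_le_of_lintegral_le_amalgamNorm {N d : ℕ} {dj : Fin N → ℕ}
    {ℓ : (j : Fin N) → EuclideanSpace ℝ (Fin d) →ₗ[ℝ] EuclideanSpace ℝ (Fin (dj j))}
    {p : Fin N → ℝ≥0∞} {C : ℝ≥0}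
    (hC : ∀ f : (j : Fin N) → EuclideanSpace ℝ (Fin (dj j)) → ℝ≥0∞,
        (∀ j, AEMeasurable (f j) volume) →
        ∫⁻ y, ∏ j, f j (ℓ j y) ≤ (C : ℝ≥0∞) * ∏ j, amalgamNorm (p j) (f j))
    (V : Submodule ℝ (EuclideanSpace ℝ (Fin d))) :
    (finrank ℝ V : ℝ) ≤ ∑ j, (p j)⁻¹.toReal * finrank ℝ (V.map (ℓ j)) := by
  choose K hK0 hK using fun j => (ℓ j).map_mem_cylinder V
  choose D hD using fun j => exists_amalgamNorm_indicator_cylinder_le (p j) (V.map (ℓ j)) (hK0 j)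
  obtain ⟨c, hc0, hc⟩ := V.exists_volume_cylinder one_pos
  refine le_of_forall_rpow_le_mul (C := ((C * ∏ j, D j ^ (p j)⁻¹.toReal) / c : ℝ≥0)) fun R hR => ?_
  have hR0 : 0 < R := by linarith
  have hmain := hC (fun j => ((V.map (ℓ j)).cylinder (K j * R) (K j)).indicator fun _ => 1)
    fun j => (measurable_const.indicator (Submodule.measurableSet_cylinder _ _ _)).aemeasurable
  have hlow : volume (V.cylinder R 1) ≤ ∫⁻ y, ∏ j,
      ((V.map (ℓ j)).cylinder (K j * R) (K j)).indicator (fun _ => (1 : ℝ≥0∞)) (ℓ j y) := by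
    rw [← lintegral_indicator_one (V.measurableSet_cylinder R 1)]
    refine lintegral_mono (Set.indicator_le fun y hy => ?_)
    exact (Finset.prod_eq_one fun j _ => Set.indicator_of_mem (hK j R hR y hy) _).ge
  have hup : ∏ j, amalgamNorm (p j)
      (((V.map (ℓ j)).cylinder (K j * R) (K j)).indicator fun _ => (1 : ℝ≥0∞)) ≤
        ∏ j, (D j * ENNReal.ofReal R ^ finrank ℝ (V.map (ℓ j))) ^ (p j)⁻¹.toReal :=
    Finset.prod_le_prod' fun j _ => hD j R hR
  have h := hlow.trans (hmain.trans (mul_le_mul_right hup C))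
  rw [hc R hR0.le] at h
  lift R to ℝ≥0 using hR0.le
  rw [ENNReal.ofReal_coe_nnreal] at h
  simp_rw [← ENNReal.coe_pow, ← ENNReal.coe_mul,
    ← ENNReal.coe_rpow_of_nonneg _ ENNReal.toReal_nonneg, ← ENNReal.ofNNReal_finsetProd,
    ← ENNReal.coe_mul, ENNReal.coe_le_coe, NNReal.mul_rpow, Finset.prod_mul_distrib] at h
  have hprod : ∏ j, (R ^ finrank ℝ (V.map (ℓ j))) ^ (p j)⁻¹.toReal =
      R ^ ∑ j, (p j)⁻¹.toReal * finrank ℝ (V.map (ℓ j)) := by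
    rw [← NNReal.coe_inj, NNReal.coe_rpow, Real.rpow_sum_of_pos hR0, NNReal.coe_prod]
    refine Finset.prod_congr rfl fun j _ => ?_
    rw [mul_comm, Real.rpow_mul hR0.le, Real.rpow_natCast, NNReal.coe_rpow, NNReal.coe_pow]
  rw [hprod] at h
  rw [Real.rpow_natCast]
  have h' : R ^ finrank ℝ V ≤ (C * ∏ j, D j ^ (p j)⁻¹.toReal) / c *
      R ^ ∑ j, (p j)⁻¹.toReal * (finrank ℝ (V.map (ℓ j)) : ℝ) := by
    rw [div_mul_eq_mul_div, le_div_iff₀ (pos_iff_ne_zero.2 hc0), mul_comm, mul_assoc]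
    exact h
  exact_mod_cast h'

theorem theorem2p5 (N d : ℕ) (dj : Fin N → ℕ)
    (ℓ : (j : Fin N) → EuclideanSpace ℝ (Fin d) →ₗ[ℝ] EuclideanSpace ℝ (Fin (dj j)))
    (hℓ : ∀ j, Function.Surjective (ℓ j))
    (p : Fin N → ℝ≥0∞) (hp : ∀ j, 1 ≤ p j) :
    (∃ C : ℝ≥0, ∀ f : (j : Fin N) → EuclideanSpace ℝ (Fin (dj j)) → ℝ≥0∞,
        (∀ j, AEMeasurable (f j) volume) →
        ∫⁻ y, ∏ j, f j (ℓ j y) ≤ (C : ℝ≥0∞) * ∏ j, amalgamNorm (p j) (f j)) ↔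
      ∀ V : Submodule ℝ (EuclideanSpace ℝ (Fin d)),
        (Module.finrank ℝ V : ℝ≥0∞) ≤
          ∑ j, (p j)⁻¹ * (Module.finrank ℝ (V.map (ℓ j)) : ℝ≥0∞) := by
  have hp1 (j : Fin N) : (p j)⁻¹ ≤ 1 := ENNReal.inv_le_one.2 (hp j)
  have hfin (j : Fin N) : (p j)⁻¹ ≠ ∞ := ((hp1 j).trans_lt ENNReal.one_lt_top).ne
  have hiff (V : Submodule ℝ (EuclideanSpace ℝ (Fin d))) :
      (finrank ℝ V : ℝ≥0∞) ≤ ∑ j, (p j)⁻¹ * (finrank ℝ (V.map (ℓ j)) : ℝ≥0∞) ↔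
        (finrank ℝ V : ℝ) ≤ ∑ j, (p j)⁻¹.toReal * finrank ℝ (V.map (ℓ j)) := by
    have hterm (j : Fin N) : (p j)⁻¹ * (finrank ℝ (V.map (ℓ j)) : ℝ≥0∞) ≠ ∞ :=
      ENNReal.mul_ne_top (hfin j) (ENNReal.natCast_ne_top _)
    rw [← ENNReal.toReal_le_toReal (ENNReal.natCast_ne_top _)
      (ENNReal.sum_ne_top.2 fun j _ => hterm j), ENNReal.toReal_sum fun j _ => hterm j]
    simp only [ENNReal.toReal_mul, ENNReal.toReal_natCast]
  simp_rw [hiff]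
  constructor
  · rintro ⟨C, hC⟩ V
    exact finrank_le_of_lintegral_le_amalgamNorm hC V
  · intro h
    have hBL : IsBLDatum ℓ fun j => (p j)⁻¹.toReal :=
      ⟨fun j => ENNReal.toReal_nonneg, fun j => ENNReal.toReal_mono ENNReal.one_ne_top (hp1 j), h⟩
    obtain ⟨C, hC⟩ := (hBL.hasBLBound _ rfl).exists_lintegral_le_amalgamNorm hℓ hp
    exact ⟨C, fun f _ => hC f⟩
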